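/- **Theorem (Soundness of the transformation rules).** *Setting.* Consider a typed first-order language whose types are the basic types (integers, booleans) and algebraic data types (ADTs), each ADT being freely generated by constructors and having at least one value. A *constraint* is a quantifier-free formula of linear integer arithmetic and booleans (equations between terms of ADT type are also admitted); $\mathbb D$ denotes the standard interpretation of constraints. An *atom* is $p(t_1,\dots,t_m)$ with $p$ a typed predicate symbol. A *clause* is $H\leftarrow c,B$, where $H$ is an atom or $\mathit{false}$, $c$ is a constraint and $B$ is a finite conjunction of atoms (its order is irrelevant); its variables are universally quantified and may be renamed (giving *variants*). It is *definite* if $H\neq\mathit{false}$. A set of clauses is *satisfiable* if some interpretation of the predicates over the standard values makes all its clauses true. For a set $P$ of definite clauses, $M(P)$ is its least model, and $\mathit{Definite}(P)$ is the set of the definite clauses of $P$. A non-empty conjunction $F(X,Y)$ of atoms, whose variables are the disjoint tuples $X,Y$ of distinct variables, is *functional* w.r.t. $P$ if $M(P)\models\forall X,Y,Z.\,F(X,Y)\wedge F(X,Z)\to Y=Z$, and *total* w.r.t. $P$ if $M(P)\models\forall X\exists Y.\,F(X,Y)$; one writes $F(X;Y)$ if it is both. A level mapping $\ell$ assigns a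 natural number to every predicate; $\ell(A)$ is the level of the predicate of the atom $A$, and $\mathit{false}$ is above all levels. A clause $H\leftarrow c,B$ is stratified if $\ell(H)\ge\ell(A)$ for every atom $A$ of $B$. *Transformation sequences.* Let $P_0$ be a set of clauses that is stratified w.r.t. $\ell$ and in whose atoms every term of basic type is a variable. A transformation sequence $P_0\Rightarrow P_1\Rightarrow\dots\Rightarrow P_n$ is one in which every $P_{i+1}$ arises from $P_i$ by one of the following rules, where $\mathit{Defs}_i$ is the set of the clauses introduced by R1 in the first $i$ steps and $\mathcal M_i=\mathit{Definite}(P_0)\cup\mathit{Defs}_i$. * **R1 (Definition).** $P_{i+1}=P_i\cup\{D\}$, $D:\ \mathit{newp}(X_1,\dots,X_k)\leftarrow c,A_1,\dots,A_m$, where $\mathit{newp}$ does not occur in $P_0,\dots,P_i$, the predicates of $A_1,\dots,A_m$ occur in $P_0$, the variables $X_1,\dots,X_k$ occur in the body of $D$, and in $A_1,\dots,A_m$ every term of basic type is a variable. One sets $\ell(\mathit{newp})=\max_j\ell(A_j)$ ($0$ if $m=0$). * **R2 (Unfolding).** $C:\ H\leftarrow c,A,G$ is in $P_i$, where the predicate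 of the atom $A$ occurs in $P_0$. $P_{i+1}=(P_i\setminus\{C\})\cup\mathit{Unf}$, where $\mathit{Unf}$ consists of the clauses $(H\leftarrow c,c',G,B)\vartheta$ for all clauses $K\leftarrow c',B$ of $P_0$ (renamed apart from $C$) such that $A$ and $K$ have a most general unifier $\vartheta$ and $(c\wedge c')\vartheta$ is satisfiable. * **R3 (Folding).** $C:\ H\leftarrow c,B\vartheta,G$ is in $P_i$, $D:\ K\leftarrow d,B$ is a variant of a clause of $\mathit{Defs}_i$, $\vartheta$ is a substitution, $H=\mathit{false}$ or $\ell(H)\ge\ell(K)$, and $\mathbb D\models\forall(c\to d\vartheta)$. $C$ is replaced by $H\leftarrow c,K\vartheta,G$. * **R4 (Clause deletion).** A clause with unsatisfiable constraint is removed. * **R5 (Functionality).** $C:\ H\leftarrow c,F(X,Y),F(X,Z),G$ is in $P_i$, $F(X,Y)$ is functional from $X$ to $Y$ w.r.t. $\mathcal M_i$ and $Z$ is a tuple of distinct variables not in $X$. $C$ is replaced by $H\leftarrow c,Y=Z,F(X,Y),G$. * **R6 (Totality).** $C:\ H\leftarrow c,F(X,Y),G$ is in $P_i$, $F(X,Y)$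 is total from $X$ to $Y$ w.r.t. $\mathcal M_i$, and no variable of $Y$ occurs in $H\leftarrow c,G$. $C$ is replaced by $H\leftarrow c,G$. * **R7 (Differential replacement).** $C:\ H\leftarrow c,F(X;Y),G$ is in $P_i$, $D:\ \mathit{diff}(Z)\leftarrow d,F(X;Y),R(V;W)$ is a variant of a clause of $\mathit{Defs}_i$, where $F(X;Y)$ and $R(V;W)$ are total and functional w.r.t. $\mathcal M_i$, no variable of $W$ occurs in $C$, $\mathbb D\models\forall(c\to d)$, and $H=\mathit{false}$ or $\ell(H)>\ell(\mathit{diff})$. $C$ is replaced by $H\leftarrow c,R(V;W),\mathit{diff}(Z),G$. *Claim.* Let $P_0\Rightarrow\dots\Rightarrow P_n$ be a transformation sequence satisfying (U) whenever $P_i\Rightarrow P_{i+1}$ is a folding step using a definition $D: H\leftarrow c,B$ in $\mathit{Defs}_i$, there is a step $P_j\Rightarrow P_{j+1}$ of the sequence that unfolds $D$ (up to renaming of variables) with respect to an atom $A$ with $\ell(A)=\ell(H)$. If $P_n$ is satisfiable, then $P_0$ is satisfiable. -/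

import Mathlib

universe u

namespace CHC

/-- The types: integers, booleans (the basic types) and the algebraic data types. -/
inductive Srt (Adt : Type u) : Type u
  | int : Srt Adt
  | bool : Srt Adt
  | adt (d : Adt) : Srt Adt

/-- A typed language: algebraic data types given by their constructors, and typed predicate symbols. -/
structure Signature where
  Adt : Type u
  Con : Type u
  conArgs : Con → List (Srt Adt)
  conRes : Con → Adt
  Pred : Type u
  predArgs : Pred → List (Srt Adt)

variable {S : Signature.{u}}

/-- Typed terms. The variables of each type are indexed by the natural numbers. -/
inductive Term (S : Signature.{u}) : Srt S.Adt → Type u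
  | var (s : Srt S.Adt) (n : ℕ) : Term S s
  | con (f : S.Con) (args : ∀ i : Fin (S.conArgs f).length, Term S ((S.conArgs f).get i)) :
      Term S (.adt (S.conRes f))
  | intLit (k : ℤ) : Term S .int
  | add (t t' : Term S .int) : Term S .int
  | neg (t : Term S .int) : Term S .int
  | smul (k : ℤ) (t : Term S .int) : Term S .int
  | boolLit (b : Bool) : Term S .bool
  | bnot (t : Term S .bool) : Term S .bool
  | band (t t' : Term S .bool) : Term S .bool
  | bor (t t' : Term S .bool) : Term S .bool

/-- Constraints: quantifier-free formulas of linear integer arithmetic and booleans.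
Equations are allowed at every type, since the functionality rule adds the conjunct `Y = Z`. -/
inductive Constraint (S : Signature.{u}) : Type u
  | tru : Constraint S
  | eq (s : Srt S.Adt) (t t' : Term S s) : Constraint S
  | le (t t' : Term S .int) : Constraint S
  | isTrue (t : Term S .bool) : Constraint S
  | not (c : Constraint S) : Constraint S
  | and (c c' : Constraint S) : Constraint S
  | or (c c' : Constraint S) : Constraint S

/-- Atoms `p(t₁,…,tₘ)`. -/
structure Atom (S : Signature.{u}) where
  pred : S.Pred
  args : ∀ i : Fin (S.predArgs pred).length, Term S ((S.predArgs pred).get i)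

/-- Clauses `H ← c, B`; the head `none` is `false`, and the conjunction `B` of atoms is taken up to
the order of the atoms. -/
structure Clause (S : Signature.{u}) where
  head : Option (Atom S)
  constr : Constraint S
  body : Multiset (Atom S)

/-! ### Variables and substitutions -/

/-- A typed variable, given by its type and its index. -/
abbrev Var (S : Signature.{u}) : Type u := Srt S.Adt × ℕ

def Term.vars {s : Srt S.Adt} : Term S s → Set (Var S)
  | .var s n => {(s, n)}
  | .con _ args => ⋃ i, (args i).vars
  | .intLit _ => ∅
  | .add t t' => t.vars ∪ t'.vars
  | .neg t => t.vars
  | .smul _ t => t.vars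
  | .boolLit _ => ∅
  | .bnot t => t.vars
  | .band t t' => t.vars ∪ t'.vars
  | .bor t t' => t.vars ∪ t'.vars

def Constraint.vars : Constraint S → Set (Var S)
  | .tru => ∅
  | .eq _ t t' => t.vars ∪ t'.vars
  | .le t t' => t.vars ∪ t'.vars
  | .isTrue t => t.vars
  | .not c => c.vars
  | .and c c' => c.vars ∪ c'.vars
  | .or c c' => c.vars ∪ c'.vars

def Atom.vars (A : Atom S) : Set (Var S) := ⋃ i, (A.args i).vars

/-- The variables of a conjunction of atoms. -/
def conjVars (F : Multiset (Atom S)) : Set (Var S) := {x | ∃ A ∈ F, x ∈ A.vars}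

def headVars : Option (Atom S) → Set (Var S)
  | none => ∅
  | some A => A.vars

def Clause.vars (C : Clause S) : Set (Var S) := headVars C.head ∪ C.constr.vars ∪ conjVars C.body

/-- Typed substitutions. -/
abbrev Subst (S : Signature.{u}) : Type u := ∀ s : Srt S.Adt, ℕ → Term S s

def Term.subst (θ : Subst S) {s : Srt S.Adt} : Term S s → Term S s
  | .var s n => θ s n
  | .con f args => .con f fun i => (args i).subst θ
  | .intLit k => .intLit k
  | .add t t' => .add (t.subst θ) (t'.subst θ)
  | .neg t => .neg (t.subst θ)
  | .smul k t => .smul k (t.subst θ)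
  | .boolLit b => .boolLit b
  | .bnot t => .bnot (t.subst θ)
  | .band t t' => .band (t.subst θ) (t'.subst θ)
  | .bor t t' => .bor (t.subst θ) (t'.subst θ)

def Constraint.subst (θ : Subst S) : Constraint S → Constraint S
  | .tru => .tru
  | .eq s t t' => .eq s (t.subst θ) (t'.subst θ)
  | .le t t' => .le (t.subst θ) (t'.subst θ)
  | .isTrue t => .isTrue (t.subst θ)
  | .not c => .not (c.subst θ)
  | .and c c' => .and (c.subst θ) (c'.subst θ)
  | .or c c' => .or (c.subst θ) (c'.subst θ)

def Atom.subst (θ : Subst S) (A : Atom S) : Atom S := ⟨A.pred, fun i => (A.args i).subst θ⟩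

def Clause.subst (θ : Subst S) (C : Clause S) : Clause S :=
  ⟨C.head.map (Atom.subst θ), C.constr.subst θ, C.body.map (Atom.subst θ)⟩

/-- The substitution that replaces variables by variables. -/
def varSubst (ρ : Srt S.Adt → ℕ → ℕ) : Subst S := fun s n => .var s (ρ s n)

/-- `C'` is a variant of `C`: it is obtained by a renaming of the variables. -/
def IsVariant (C C' : Clause S) : Prop :=
  ∃ ρ : Srt S.Adt → Equiv.Perm ℕ, C' = C.subst (varSubst fun s => ρ s)

def IsUnifier (θ : Subst S) (A B : Atom S) : Prop := A.subst θ = B.subst θ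

def Unifiable (A B : Atom S) : Prop := ∃ θ, IsUnifier θ A B

/-- `θ` is a most general unifier of `A` and `B`. -/
def IsMGU (θ : Subst S) (A B : Atom S) : Prop :=
  IsUnifier θ A B ∧
    ∀ σ, IsUnifier σ A B → ∃ τ : Subst S, ∀ s n, (θ s n).subst τ = σ s n

/-- Every subterm of basic type is a variable. -/
def Term.BasicVars {s : Srt S.Adt} : Term S s → Prop
  | .var _ _ => True
  | .con _ args => ∀ i, (args i).BasicVars
  | .intLit _ => False
  | .add _ _ => False
  | .neg _ => False
  | .smul _ _ => False
  | .boolLit _ => False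
  | .bnot _ => False
  | .band _ _ => False
  | .bor _ _ => False

def Atom.BasicVars (A : Atom S) : Prop := ∀ i, (A.args i).BasicVars

/-- In every atom of the clause each term of basic type is a variable. -/
def Clause.BasicVars (C : Clause S) : Prop :=
  (∀ A ∈ C.head, A.BasicVars) ∧ ∀ A ∈ C.body, A.BasicVars

/-! ### Semantics -/

/-- The values of each type: integers, booleans, and for an algebraic data type the values freely
generated by its constructors. -/
inductive Val (S : Signature.{u}) : Srt S.Adt → Type u
  | int (k : ℤ) : Val S .int
  | bool (b : Bool) : Val S .bool
  | con (f : S.Con) (args : ∀ i : Fin (S.conArgs f).length, Val S ((S.conArgs f).get i)) :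
      Val S (.adt (S.conRes f))

def Val.toInt : Val S .int → ℤ
  | .int k => k

def Val.toBool : Val S .bool → Bool
  | .bool b => b

abbrev Valuation (S : Signature.{u}) : Type u := ∀ s : Srt S.Adt, ℕ → Val S s

def Term.eval (v : Valuation S) {s : Srt S.Adt} : Term S s → Val S s
  | .var s n => v s n
  | .con f args => .con f fun i => (args i).eval v
  | .intLit k => .int k
  | .add t t' => .int ((t.eval v).toInt + (t'.eval v).toInt)
  | .neg t => .int (-(t.eval v).toInt)
  | .smul k t => .int (k * (t.eval v).toInt)
  | .boolLit b => .bool b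
  | .bnot t => .bool (!(t.eval v).toBool)
  | .band t t' => .bool ((t.eval v).toBool && (t'.eval v).toBool)
  | .bor t t' => .bool ((t.eval v).toBool || (t'.eval v).toBool)

def Constraint.Holds (v : Valuation S) : Constraint S → Prop
  | .tru => True
  | .eq _ t t' => t.eval v = t'.eval v
  | .le t t' => (t.eval v).toInt ≤ (t'.eval v).toInt
  | .isTrue t => (t.eval v).toBool = true
  | .not c => ¬ c.Holds v
  | .and c c' => c.Holds v ∧ c'.Holds v
  | .or c c' => c.Holds v ∨ c'.Holds v

def Constraint.Satisfiable (c : Constraint S) : Prop := ∃ v, c.Holds v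

/-- `∀ (c → d)` is true. -/
def Constraint.Entails (c d : Constraint S) : Prop := ∀ v, c.Holds v → d.Holds v

/-- An interpretation of the predicate symbols, that is, a set of ground atoms; everything else has
its fixed interpretation. -/
abbrev Interp (S : Signature.{u}) : Type u :=
  ∀ p : S.Pred, (∀ i : Fin (S.predArgs p).length, Val S ((S.predArgs p).get i)) → Prop

def Atom.Holds (I : Interp S) (v : Valuation S) (A : Atom S) : Prop :=
  I A.pred fun i => (A.args i).eval v

def ConjHolds (I : Interp S) (v : Valuation S) (F : Multiset (Atom S)) : Prop :=
  ∀ A ∈ F, A.Holds I v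

def HeadHolds (I : Interp S) (v : Valuation S) : Option (Atom S) → Prop
  | none => False
  | some A => A.Holds I v

def Clause.IsTrueIn (I : Interp S) (C : Clause S) : Prop :=
  ∀ v, C.constr.Holds v → ConjHolds I v C.body → HeadHolds I v C.head

def IsModel (I : Interp S) (P : Set (Clause S)) : Prop := ∀ C ∈ P, C.IsTrueIn I

/-- Satisfiability of a set of clauses. -/
def Satisfiable (P : Set (Clause S)) : Prop := ∃ I, IsModel I P

/-- The definite clauses of `P`. -/
def definite (P : Set (Clause S)) : Set (Clause S) := {C ∈ P | C.head ≠ none}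

/-- `M(P)`: the set of the ground atoms that are true in all models of `P`. -/
def leastModel (P : Set (Clause S)) : Interp S := fun p a => ∀ I, IsModel I P → I p a

/-! ### Functional and total conjunctions -/

/-- `F` can be written `F(X,Y)`: it has at least one atom, and `X`, `Y` are disjoint tuples of
distinct variables that together are the variables of `F`. -/
def IsConj (F : Multiset (Atom S)) (X Y : List (Var S)) : Prop :=
  F ≠ 0 ∧ X.Nodup ∧ Y.Nodup ∧ X.Disjoint Y ∧ ∀ x, x ∈ conjVars F ↔ x ∈ X ∨ x ∈ Y

/-- `M(P) ⊨ ∀ X,Y,Z. F(X,Y) ∧ F(X,Z) → Y = Z`. -/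
def IsFunctional (P : Set (Clause S)) (F : Multiset (Atom S)) (X Y : List (Var S)) : Prop :=
  IsConj F X Y ∧ ∀ v w : Valuation S, (∀ x ∈ X, v x.1 x.2 = w x.1 x.2) →
    ConjHolds (leastModel P) v F → ConjHolds (leastModel P) w F →
      ∀ y ∈ Y, v y.1 y.2 = w y.1 y.2

/-- `M(P) ⊨ ∀ X ∃ Y. F(X,Y)`. -/
def IsTotal (P : Set (Clause S)) (F : Multiset (Atom S)) (X Y : List (Var S)) : Prop :=
  IsConj F X Y ∧ ∀ v : Valuation S, ∃ w : Valuation S,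
    (∀ x ∈ X, w x.1 x.2 = v x.1 x.2) ∧ ConjHolds (leastModel P) w F

/-! ### Levels -/

/-- The level of the head of a clause; `false` lies above every predicate. -/
def headLevel (ℓ : S.Pred → ℕ) : Option (Atom S) → WithTop ℕ
  | none => ⊤
  | some A => (ℓ A.pred : WithTop ℕ)

def Clause.Stratified (ℓ : S.Pred → ℕ) (C : Clause S) : Prop :=
  ∀ A ∈ C.body, (ℓ A.pred : WithTop ℕ) ≤ headLevel ℓ C.head

/-- The predicate `p` occurs in the set `P` of clauses. -/
def OccursIn (p : S.Pred) (P : Set (Clause S)) : Prop :=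
  ∃ C ∈ P, (∃ A ∈ C.head, A.pred = p) ∨ ∃ A ∈ C.body, A.pred = p

/-! ### The transformation rules -/

/-- (R1) The clause `D : newp(X₁,…,X_k) ← c, A₁,…,A_m` may be introduced after `P 0, …, P i`. -/
def DefinitionRule (ℓ : S.Pred → ℕ) (P : ℕ → Set (Clause S)) (i : ℕ) (D : Clause S) : Prop :=
  D.BasicVars ∧ ∃ K, D.head = some K ∧
    (∀ j ≤ i, ¬ OccursIn K.pred (P j)) ∧
    (∀ A ∈ D.body, OccursIn A.pred (P 0)) ∧
    (∀ k, ∃ x, K.args k = .var _ x) ∧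
    K.vars ⊆ D.constr.vars ∪ conjVars D.body ∧
    ℓ K.pred = (D.body.map fun A => ℓ A.pred).sup

/-- The resolvent `(H ← c, c', G, B)θ` of the clause `H ← c, A, G` with a clause `K ← c', B`. -/
def resolvent (C : Clause S) (G : Multiset (Atom S)) (K : Clause S) (θ : Subst S) : Clause S :=
  Clause.subst θ ⟨C.head, .and C.constr K.constr, G + K.body⟩

/-- (R2) `U` is the set `Unf(C,A,P₀)`, with the clauses `K` of `P₀` renamed apart from `C` by `ren`
and with the most general unifiers `mgu K`. -/
def UnfoldingRule (P₀ : Set (Clause S)) (C : Clause S) (A : Atom S) (U : Set (Clause S)) : Prop :=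
  OccursIn A.pred P₀ ∧ ∃ G, C.body = A ::ₘ G ∧
    ∃ (ren : Clause S → Clause S) (mgu : Clause S → Subst S),
      (∀ K ∈ P₀, IsVariant K (ren K) ∧ Disjoint C.vars (ren K).vars ∧
        ∀ B, (ren K).head = some B → Unifiable A B → IsMGU (mgu K) A B) ∧
      U = {E | ∃ K ∈ P₀, ∃ B, (ren K).head = some B ∧ Unifiable A B ∧
        (Constraint.subst (mgu K) (.and C.constr (ren K).constr)).Satisfiable ∧
        E = resolvent C G (ren K) (mgu K)}

/-- (R3) Folding the clause `C` using the definition `D` gives `E`. -/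
def FoldingRule (ℓ : S.Pred → ℕ) (C D E : Clause S) : Prop :=
  ∃ D' K G, ∃ θ : Subst S, IsVariant D D' ∧ D'.head = some K ∧
    (ℓ K.pred : WithTop ℕ) ≤ headLevel ℓ C.head ∧
    C.body = G + D'.body.map (Atom.subst θ) ∧
    C.constr.Entails (D'.constr.subst θ) ∧
    E = ⟨C.head, C.constr, G + {K.subst θ}⟩

/-- The constraint `Y = Z`, where `Z` is the image of the tuple `Y` under `ρ`. -/
def tupleEq (ρ : Srt S.Adt → ℕ → ℕ) : List (Var S) → Constraint S
  | [] => .tru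
  | y :: Y => .and (.eq y.1 (.var y.1 y.2) (.var y.1 (ρ y.1 y.2))) (tupleEq ρ Y)

/-- (R5) Functionality with respect to the definite clauses `Q` turns `C` into `E`. Here `ρ` maps
the tuple `Y` to the tuple `Z` and fixes `X`, so that it maps `F(X,Y)` to `F(X,Z)`. -/
def FunctionalityRule (Q : Set (Clause S)) (C E : Clause S) : Prop :=
  ∃ (F G : Multiset (Atom S)) (X Y : List (Var S)) (ρ : Srt S.Adt → ℕ → ℕ),
    IsFunctional Q F X Y ∧
    (∀ x ∈ X, ρ x.1 x.2 = x.2) ∧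
    (Y.map fun y => (y.1, ρ y.1 y.2)).Nodup ∧
    (Y.map fun y => (y.1, ρ y.1 y.2)).Disjoint X ∧
    C.body = G + F + F.map (Atom.subst (varSubst ρ)) ∧
    E = ⟨C.head, .and C.constr (tupleEq ρ Y), G + F⟩

/-- (R6) Totality with respect to the definite clauses `Q` turns `C` into `E`. -/
def TotalityRule (Q : Set (Clause S)) (C E : Clause S) : Prop :=
  ∃ (F G : Multiset (Atom S)) (X Y : List (Var S)),
    IsTotal Q F X Y ∧ C.body = G + F ∧ E = ⟨C.head, C.constr, G⟩ ∧ ∀ y ∈ Y, y ∉ E.vars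

/-- (R7) Differential replacement in `C` using the definition `D`, with respect to the definite
clauses `Q`, gives `E`. -/
def DifferentialReplacementRule (ℓ : S.Pred → ℕ) (Q : Set (Clause S)) (C D E : Clause S) : Prop :=
  ∃ (D' : Clause S) (K : Atom S) (F R G : Multiset (Atom S)) (X Y V W : List (Var S)),
    IsVariant D D' ∧ D'.head = some K ∧ D'.body = F + R ∧ C.body = G + F ∧
    IsFunctional Q F X Y ∧ IsTotal Q F X Y ∧ IsFunctional Q R V W ∧ IsTotal Q R V W ∧
    (∀ w ∈ W, w ∉ C.vars) ∧
    C.constr.Entails D'.constr ∧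
    (ℓ K.pred : WithTop ℕ) < headLevel ℓ C.head ∧
    E = ⟨C.head, C.constr, G + R + {K}⟩

/-- The rule applied in one step, with the clauses (and the atom) that it concerns. -/
inductive RuleApp (S : Signature.{u}) : Type u
  | definition (D : Clause S)
  | unfolding (C : Clause S) (A : Atom S)
  | folding (C D : Clause S)
  | clauseDeletion (C : Clause S)
  | functionality (C : Clause S)
  | totality (C : Clause S)
  | differentialReplacement (C D : Clause S)

/-- `Defs_i`: the definitions introduced in the first `i` steps. -/
def defsAt (r : ℕ → RuleApp S) (i : ℕ) : Set (Clause S) := {D | ∃ k < i, r k = .definition D}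

/-- `P' = (P \ {C}) ∪ {E}`, where `C ∈ P` and the variables of `E` may be renamed. -/
def Replaced (P P' : Set (Clause S)) (C E : Clause S) : Prop :=
  C ∈ P ∧ ∃ E', IsVariant E E' ∧ P' = (P \ {C}) ∪ {E'}

/-- `P (i+1)` is derived from `P i` by the rule application `a`. -/
def Step (ℓ : S.Pred → ℕ) (P : ℕ → Set (Clause S)) (r : ℕ → RuleApp S) (i : ℕ) :
    RuleApp S → Prop
  | .definition D => DefinitionRule ℓ P i D ∧ P (i + 1) = P i ∪ {D}
  | .unfolding C A => C ∈ P i ∧ ∃ U, UnfoldingRule (P 0) C A U ∧ P (i + 1) = (P i \ {C}) ∪ U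
  | .folding C D => D ∈ defsAt r i ∧ ∃ E, FoldingRule ℓ C D E ∧ Replaced (P i) (P (i + 1)) C E
  | .clauseDeletion C => C ∈ P i ∧ ¬ C.constr.Satisfiable ∧ P (i + 1) = P i \ {C}
  | .functionality C => ∃ E, FunctionalityRule (definite (P 0) ∪ defsAt r i) C E ∧
      Replaced (P i) (P (i + 1)) C E
  | .totality C => ∃ E, TotalityRule (definite (P 0) ∪ defsAt r i) C E ∧
      Replaced (P i) (P (i + 1)) C E
  | .differentialReplacement C D => D ∈ defsAt r i ∧
      ∃ E, DifferentialReplacementRule ℓ (definite (P 0) ∪ defsAt r i) C D E ∧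
        Replaced (P i) (P (i + 1)) C E

/-- `P 0 ⇒ P 1 ⇒ … ⇒ P n` is a transformation sequence, `r i` being the rule application of the
step `P i ⇒ P (i+1)`. The level mapping `ℓ` already includes the levels of the new predicates. -/
def IsTransformationSequence (ℓ : S.Pred → ℕ) (n : ℕ) (P : ℕ → Set (Clause S))
    (r : ℕ → RuleApp S) : Prop :=
  (∀ C ∈ P 0, C.BasicVars) ∧ (∀ C ∈ P 0, C.Stratified ℓ) ∧ ∀ i < n, Step ℓ P r i (r i)

/-- Condition (U): every definition used for folding is unfolded at some step with respect to an
atom that has the level of its head. -/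
def ConditionU (ℓ : S.Pred → ℕ) (n : ℕ) (r : ℕ → RuleApp S) : Prop :=
  ∀ i < n, ∀ C D, r i = .folding C D →
    ∃ j < n, ∃ D' A, IsVariant D D' ∧ r j = .unfolding D' A ∧
      headLevel ℓ D.head = (ℓ A.pred : WithTop ℕ)

end CHC

/-! Let `M` be the least model of the definite initial clauses together with all definitions. `M` is
a model of the initial set: if some goal `false ← c, B` failed in it, the failing instance could be
followed through the sequence to an instance with head `false` in the last set whose body is still
true in `M`. Every model of the last set contains `M` (`leastModel_le`), so such an instance
contradicts its satisfiability.

For the containment, each atom true in `M` must head an instance of a last clause whose body is true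
in `M` and consists of smaller atoms in a well-founded order. Truth of the body alone is not enough:
folding a definition with itself could yield `newp ← newp`. Atoms are therefore compared first by
level, then by `weight`, the least cost of a proof in which an initial clause costs one, a
definition costs nothing, and only uses at the level of the atom count. Weights below the head level
are irrelevant, since a drop in level already gives descent; hence differential replacement may add
lower atoms of any weight.

`Covered` is the invariant carried along the sequence. An initial clause gives a body strictly
lighter than the head; a definition gives only a body no heavier. Unfolding at the head level gains
the missing unit, and condition (U) provides such an unfolding for every definition used in folding.
Body atoms at the head level always have `foldable` predicates, so the remaining definitions, where
weight may stay equal, are never followed by another such atom at the same level; a tie-breaking bit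
closes the induction. The invariant survives one step by `covered_succ`, and `covered_of_leastModel`
reads off its consequence for the last set. -/

namespace CHC

variable {S : Signature.{u}}

/-! ### Evaluation and substitution -/

/-- The valuation obtained by evaluating a substitution. -/
def Subst.eval (θ : Subst S) (v : Valuation S) : Valuation S := fun s n => (θ s n).eval v

theorem Term.eval_subst (θ : Subst S) (v : Valuation S) {s : Srt S.Adt} (t : Term S s) :
    (t.subst θ).eval v = t.eval (θ.eval v) := by
  induction t <;> simp_all [Term.subst, Term.eval, Subst.eval]

theorem Term.eval_congr {v w : Valuation S} {s : Srt S.Adt} (t : Term S s)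
    (h : ∀ x ∈ t.vars, v x.1 x.2 = w x.1 x.2) : t.eval v = t.eval w := by
  induction t with
  | var s n => exact h (s, n) rfl
  | con f args ih =>
    simp only [Term.eval]
    congr 1
    funext i
    exact ih i fun x hx => h x (Set.mem_iUnion.2 ⟨i, hx⟩)
  | intLit k => rfl
  | boolLit b => rfl
  | neg t ih => simp only [Term.eval, ih h]
  | smul k t ih => simp only [Term.eval, ih h]
  | bnot t ih => simp only [Term.eval, ih h]
  | add t t' ih ih' =>
    simp only [Term.eval, ih fun x hx => h x (Or.inl hx), ih' fun x hx => h x (Or.inr hx)]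
  | band t t' ih ih' =>
    simp only [Term.eval, ih fun x hx => h x (Or.inl hx), ih' fun x hx => h x (Or.inr hx)]
  | bor t t' ih ih' =>
    simp only [Term.eval, ih fun x hx => h x (Or.inl hx), ih' fun x hx => h x (Or.inr hx)]

theorem Constraint.holds_subst (θ : Subst S) (v : Valuation S) (c : Constraint S) :
    (c.subst θ).Holds v ↔ c.Holds (θ.eval v) := by
  induction c <;> simp_all [Constraint.subst, Constraint.Holds, Term.eval_subst]

theorem Constraint.holds_congr {v w : Valuation S} (c : Constraint S)
    (h : ∀ x ∈ c.vars, v x.1 x.2 = w x.1 x.2) : c.Holds v ↔ c.Holds w := by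
  induction c with
  | tru => rfl
  | eq s t t' =>
    simp only [Constraint.Holds, t.eval_congr fun x hx => h x (Or.inl hx),
      t'.eval_congr fun x hx => h x (Or.inr hx)]
  | le t t' =>
    simp only [Constraint.Holds, t.eval_congr fun x hx => h x (Or.inl hx),
      t'.eval_congr fun x hx => h x (Or.inr hx)]
  | isTrue t => simp only [Constraint.Holds, t.eval_congr h]
  | not c ih => simp only [Constraint.Holds, ih h]
  | and c c' ih ih' =>
    simp only [Constraint.Holds, ih fun x hx => h x (Or.inl hx), ih' fun x hx => h x (Or.inr hx)]
  | or c c' ih ih' =>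
    simp only [Constraint.Holds, ih fun x hx => h x (Or.inl hx), ih' fun x hx => h x (Or.inr hx)]

/-- Ground atoms. -/
abbrev Ground (S : Signature.{u}) : Type u :=
  Σ p : S.Pred, ∀ i : Fin (S.predArgs p).length, Val S ((S.predArgs p).get i)

/-- The ground instance of an atom under a valuation. -/
def Atom.ground (v : Valuation S) (A : Atom S) : Ground S := ⟨A.pred, fun i => (A.args i).eval v⟩

theorem Atom.ground_subst (θ : Subst S) (v : Valuation S) (A : Atom S) :
    (A.subst θ).ground v = A.ground (θ.eval v) := by
  simp only [Atom.ground, Atom.subst, Term.eval_subst]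

theorem Atom.ground_congr {v w : Valuation S} (A : Atom S)
    (h : ∀ x ∈ A.vars, v x.1 x.2 = w x.1 x.2) : A.ground v = A.ground w := by
  have : ∀ i, (A.args i).eval v = (A.args i).eval w := fun i =>
    (A.args i).eval_congr fun x hx => h x (Set.mem_iUnion.2 ⟨i, hx⟩)
  simp only [Atom.ground, this]

theorem Atom.holds_iff_of_ground_eq {I : Interp S} {v w : Valuation S} {A B : Atom S}
    (h : A.ground v = B.ground w) : A.Holds I v ↔ B.Holds I w := by
  change I (A.ground v).1 (A.ground v).2 ↔ I (B.ground w).1 (B.ground w).2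
  rw [h]

theorem Atom.holds_subst {I : Interp S} (θ : Subst S) (v : Valuation S) (A : Atom S) :
    (A.subst θ).Holds I v ↔ A.Holds I (θ.eval v) :=
  Atom.holds_iff_of_ground_eq (A.ground_subst θ v)

theorem conjHolds_map_subst {I : Interp S} (θ : Subst S) (v : Valuation S)
    (F : Multiset (Atom S)) :
    ConjHolds I v (F.map (Atom.subst θ)) ↔ ConjHolds I (θ.eval v) F := by
  simp [ConjHolds, Atom.holds_subst]

theorem conjHolds_add {I : Interp S} {v : Valuation S} {F G : Multiset (Atom S)} :
    ConjHolds I v (F + G) ↔ ConjHolds I v F ∧ ConjHolds I v G := by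
  simp only [ConjHolds, Multiset.mem_add, or_imp, forall_and]

theorem conjHolds_congr {I : Interp S} {v w : Valuation S} {F : Multiset (Atom S)}
    (h : ∀ x ∈ conjVars F, v x.1 x.2 = w x.1 x.2) : ConjHolds I v F ↔ ConjHolds I w F :=
  forall₂_congr fun A hA =>
    Atom.holds_iff_of_ground_eq (A.ground_congr fun x hx => h x ⟨A, hA, hx⟩)

/-- Renaming loses no valuations: precomposing with the inverse permutations undoes it. This is what
moves instances of a clause to its variants. -/
theorem varSubst_symm_eval (ρ : Srt S.Adt → Equiv.Perm ℕ) (v : Valuation S) :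
    (varSubst fun s => ρ s).eval (fun s n => v s ((ρ s).symm n)) = v := by
  funext s n
  simp [Subst.eval, varSubst, Term.eval]

/-! ### Values as terms, and unification -/

/-- A value as a term in which every basic value is represented by a variable. -/
def Val.toTerm {s : Srt S.Adt} : Val S s → Term S s
  | .int k => .var _ (Equiv.intEquivNat k)
  | .bool b => .var _ (Encodable.encode b)
  | .con f args => .con f fun i => (args i).toTerm

/-- A valuation under which `Val.toTerm x` has the value `x`. -/
noncomputable def decodeValuation (hne : ∀ s : Srt S.Adt, Nonempty (Val S s)) : Valuation S
  | .int, n => .int (Equiv.intEquivNat.symm n)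
  -- Only codes of booleans occur in `Val.toTerm`, so the default `false` is never met; likewise no
  -- variable of ADT type occurs there, and any value will do for those.
  | .bool, n => .bool ((Encodable.decode n).getD false)
  | .adt d, _ => (hne (.adt d)).some

theorem Val.eval_toTerm (hne : ∀ s : Srt S.Adt, Nonempty (Val S s)) {s : Srt S.Adt}
    (x : Val S s) : x.toTerm.eval (decodeValuation hne) = x := by
  induction x with
  | int k => simp [Val.toTerm, Term.eval, decodeValuation]
  | bool b => simp [Val.toTerm, Term.eval, decodeValuation]
  | con f args ih => simp [Val.toTerm, Term.eval, ih]

theorem Val.basicVars_toTerm {s : Srt S.Adt} (x : Val S s) : x.toTerm.BasicVars := by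
  induction x with
  | int k => trivial
  | bool b => trivial
  | con f args ih => exact ih

/-- Without interpreted operations, syntactic instantiation mirrors evaluation. With a term such as
`x + 1` it would not: the sum stays a sum instead of becoming the variable that codes its value. -/
theorem Term.BasicVars.subst_toTerm {s : Srt S.Adt} {t : Term S s} (ht : t.BasicVars)
    (v : Valuation S) : t.subst (fun s n => (v s n).toTerm) = (t.eval v).toTerm := by
  induction t with
  | var s n => rfl
  | con f args ih =>
    simp only [Term.subst, Term.eval, Val.toTerm]
    congr 1
    funext i
    exact ih i (ht i)
  | _ => exact ht.elim

theorem Term.BasicVars.subst {θ : Subst S} (hθ : ∀ s n, (θ s n).BasicVars) {s : Srt S.Adt}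
    {t : Term S s} (ht : t.BasicVars) : (t.subst θ).BasicVars := by
  induction t with
  | var s n => exact hθ s n
  | con f args ih => exact fun i => ih i (ht i)
  | _ => exact ht.elim

theorem Term.BasicVars.of_subst {θ : Subst S} {s : Srt S.Adt} {t : Term S s}
    (ht : (t.subst θ).BasicVars) : t.BasicVars := by
  induction t with
  | var s n => trivial
  | con f args ih => exact fun i => ih i (ht i)
  | _ => exact ht.elim

theorem Atom.BasicVars.subst {θ : Subst S} (hθ : ∀ s n, (θ s n).BasicVars) {A : Atom S}
    (hA : A.BasicVars) : (A.subst θ).BasicVars := fun i => (hA i).subst hθ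

theorem basicVars_varSubst (ρ : Srt S.Adt → ℕ → ℕ) (s : Srt S.Adt) (n : ℕ) :
    (varSubst (S := S) ρ s n).BasicVars := trivial

theorem Atom.BasicVars.subst_toTerm {A : Atom S} (hA : A.BasicVars) (v : Valuation S) :
    A.subst (fun s n => (v s n).toTerm) =
      ⟨(A.ground v).1, fun i => ((A.ground v).2 i).toTerm⟩ := by
  have : ∀ i, (A.args i).subst (fun s n => (v s n).toTerm) = ((A.args i).eval v).toTerm :=
    fun i => (hA i).subst_toTerm v
  simp only [Atom.subst, Atom.ground, this]

/-- Atoms without compound basic terms that have a common ground instance are unifiable. -/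
theorem isUnifier_of_ground_eq {A B : Atom S} (hA : A.BasicVars) (hB : B.BasicVars)
    {v : Valuation S} (h : A.ground v = B.ground v) :
    IsUnifier (fun s n => (v s n).toTerm) A B := by
  rw [IsUnifier, hA.subst_toTerm, hB.subst_toTerm, h]

/-- A most general unifier represents every valuation that makes the two atoms equal. -/
theorem IsMGU.exists_eval_eq (hne : ∀ s : Srt S.Adt, Nonempty (Val S s)) {θ : Subst S}
    {A B : Atom S} (hθ : IsMGU θ A B) (hA : A.BasicVars) (hB : B.BasicVars) {v : Valuation S}
    (h : A.ground v = B.ground v) : ∃ w, θ.eval w = v := by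
  obtain ⟨τ, hτ⟩ := hθ.2 _ (isUnifier_of_ground_eq hA hB h)
  refine ⟨τ.eval (decodeValuation hne), ?_⟩
  funext s n
  rw [Subst.eval, ← Term.eval_subst, hτ, Val.eval_toTerm]

/-- The unifier read off from a common ground instance has only variables in basic positions and is
an instance of the most general one; instantiation cannot remove a compound basic term. -/
theorem IsMGU.basicVars (hne : ∀ s : Srt S.Adt, Nonempty (Val S s)) {θ : Subst S}
    {A B : Atom S} (hθ : IsMGU θ A B) (hA : A.BasicVars) (hB : B.BasicVars) (s : Srt S.Adt)
    (n : ℕ) : (θ s n).BasicVars := by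
  have h : A.ground (θ.eval (decodeValuation hne)) = B.ground (θ.eval (decodeValuation hne)) := by
    rw [← Atom.ground_subst, ← Atom.ground_subst, hθ.1]
  obtain ⟨τ, hτ⟩ := hθ.2 _ (isUnifier_of_ground_eq hA hB h)
  refine Term.BasicVars.of_subst (θ := τ) ?_
  rw [hτ]
  exact Val.basicVars_toTerm _

/-! ### Least models and weights of ground atoms -/

theorem leastModel_isModel {Q : Set (Clause S)} (hQ : ∀ C ∈ Q, C.head ≠ none) :
    IsModel (leastModel Q) Q := by
  intro C hC v hc hB
  cases hK : C.head with
  | none => exact absurd hK (hQ C hC)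
  | some K =>
    intro I hI
    have := hI C hC v hc fun A hA => hB A hA I hI
    rwa [hK] at this

theorem leastModel_mono {Q Q' : Set (Clause S)} (h : Q ⊆ Q') {v : Valuation S} {A : Atom S}
    (hA : A.Holds (leastModel Q) v) : A.Holds (leastModel Q') v :=
  fun I hI => hA I fun C hC => hI C (h hC)

/-- Adding clauses whose head predicates occur in no body does not change the other predicates. -/
theorem leastModel_of_union {Q Q' : Set (Clause S)} (N : Set S.Pred)
    (hbody : ∀ C ∈ Q, ∀ A ∈ C.body, A.pred ∉ N)
    (hhead : ∀ C ∈ Q', C ∈ Q ∨ ∃ K, C.head = some K ∧ K.pred ∈ N)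
    {v : Valuation S} {A : Atom S} (hA : A.Holds (leastModel Q') v) (hN : A.pred ∉ N) :
    A.Holds (leastModel Q) v := by
  intro I hI
  -- Make every predicate of `N` true everywhere: clauses with head in `N` become trivial, and the
  -- clauses of `Q` do not notice, as `N` is absent from their bodies.
  refine (hA (fun p a => p ∈ N ∨ I p a) ?_).resolve_left hN
  intro C hC w hc hB
  rcases hhead C hC with hC | ⟨K, hK, hKN⟩
  · have := hI C hC w hc fun B hBC => (hB B hBC).resolve_left (hbody C hC B hBC)
    cases hK : C.head with
    | none => rw [hK] at this; exact this.elim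
    | some K => rw [hK] at this; exact Or.inr this
  · rw [hK]
    exact Or.inl hKN

/-- The sum of the weights of those atoms of a conjunction whose level is `L`. -/
def levelWeight (ℓ : S.Pred → ℕ) (w : Ground S → ℕ) (L : WithTop ℕ) (v : Valuation S)
    (F : Multiset (Atom S)) : ℕ :=
  (F.map fun A => if (ℓ A.pred : WithTop ℕ) = L then w (A.ground v) else 0).sum

section levelWeight

variable {ℓ : S.Pred → ℕ} {w : Ground S → ℕ} {L : WithTop ℕ} {v : Valuation S}

theorem levelWeight_add (F G : Multiset (Atom S)) :
    levelWeight ℓ w L v (F + G) = levelWeight ℓ w L v F + levelWeight ℓ w L v G := by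
  simp [levelWeight]

theorem levelWeight_singleton (A : Atom S) :
    levelWeight ℓ w L v {A} = if (ℓ A.pred : WithTop ℕ) = L then w (A.ground v) else 0 := by
  simp [levelWeight]

theorem levelWeight_map_subst (θ : Subst S) (F : Multiset (Atom S)) :
    levelWeight ℓ w L v (F.map (Atom.subst θ)) = levelWeight ℓ w L (θ.eval v) F := by
  simp only [levelWeight, Multiset.map_map, Function.comp_def, Atom.ground_subst]
  rfl

theorem levelWeight_congr {v' : Valuation S} {F : Multiset (Atom S)}
    (h : ∀ x ∈ conjVars F, v x.1 x.2 = v' x.1 x.2) :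
    levelWeight ℓ w L v F = levelWeight ℓ w L v' F := by
  refine congrArg Multiset.sum (Multiset.map_congr rfl fun A hA => ?_)
  rw [A.ground_congr fun x hx => h x ⟨A, hA, hx⟩]

theorem levelWeight_eq_zero {F : Multiset (Atom S)}
    (h : ∀ A ∈ F, (ℓ A.pred : WithTop ℕ) ≠ L) : levelWeight ℓ w L v F = 0 := by
  refine Multiset.sum_eq_zero fun k hk => ?_
  obtain ⟨A, hA, rfl⟩ := Multiset.mem_map.1 hk
  exact if_neg (h A hA)

theorem levelWeight_le {w' : Ground S → ℕ} {F : Multiset (Atom S)}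
    (h : ∀ A ∈ F, w (A.ground v) ≤ w' (A.ground v)) :
    levelWeight ℓ w L v F ≤ levelWeight ℓ w' L v F := by
  refine Multiset.sum_map_le_sum_map _ _ fun A hA => ?_
  split_ifs
  · exact h A hA
  · exact le_rfl

theorem weight_le_levelWeight {F : Multiset (Atom S)} {A : Atom S} (hA : A ∈ F)
    (hL : (ℓ A.pred : WithTop ℕ) = L) : w (A.ground v) ≤ levelWeight ℓ w L v F := by
  obtain ⟨G, rfl⟩ := Multiset.exists_cons_of_mem hA
  rw [← Multiset.singleton_add, levelWeight_add, levelWeight_singleton, if_pos hL]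
  exact Nat.le_add_right _ _

end levelWeight

/-- `Derives ℓ cost Q g k`: the ground atom `g` has a proof from `Q` in which the uses of clauses at
the level of `g` cost `k` altogether. -/
inductive Derives (ℓ : S.Pred → ℕ) (cost : Clause S → ℕ) (Q : Set (Clause S)) :
    Ground S → ℕ → Prop
  | intro (C : Clause S) (hC : C ∈ Q) (K : Atom S) (hK : C.head = some K) (v : Valuation S)
      (hc : C.constr.Holds v) (f : Ground S → ℕ)
      (hf : ∀ A ∈ C.body, Derives ℓ cost Q (A.ground v) (f (A.ground v))) :
      Derives ℓ cost Q (K.ground v) (cost C + levelWeight ℓ f (ℓ K.pred) v C.body)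

/-- The least cost of a proof of a ground atom. -/
noncomputable def weight (ℓ : S.Pred → ℕ) (cost : Clause S → ℕ) (Q : Set (Clause S))
    (g : Ground S) : ℕ := sInf {k | Derives ℓ cost Q g k}

section weight

variable {ℓ : S.Pred → ℕ} {cost : Clause S → ℕ} {Q : Set (Clause S)}

theorem Derives.weight {g : Ground S} {k : ℕ} (h : Derives ℓ cost Q g k) :
    Derives ℓ cost Q g (weight ℓ cost Q g) :=
  Nat.sInf_mem (s := {k | Derives ℓ cost Q g k}) ⟨k, h⟩

theorem Derives.leastModel {g : Ground S} {k : ℕ} (h : Derives ℓ cost Q g k) :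
    leastModel Q g.1 g.2 := by
  intro I hI
  induction h with
  | intro C hC K hK v hc f hf ih =>
    have := hI C hC v hc ih
    rwa [hK] at this

/-- The atoms with some proof form a model of `Q`, so they include the least model; for each body
atom one takes a cheapest proof. -/
theorem derives_weight (hQ : ∀ C ∈ Q, C.head ≠ none) {g : Ground S}
    (h : leastModel Q g.1 g.2) : Derives ℓ cost Q g (weight ℓ cost Q g) := by
  have key : ∃ k, Derives ℓ cost Q ⟨g.1, g.2⟩ k := by
    refine h (fun p a => ∃ k, Derives ℓ cost Q ⟨p, a⟩ k) ?_
    intro C hC v hc hB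
    cases hK : C.head with
    | none => exact absurd hK (hQ C hC)
    | some K =>
      refine ⟨_, Derives.intro C hC K hK v hc (CHC.weight ℓ cost Q) fun A hA => ?_⟩
      obtain ⟨k, hk⟩ := hB A hA
      exact Derives.weight (g := A.ground v) hk
  obtain ⟨k, hk⟩ := key
  exact hk.weight

theorem weight_le (hQ : ∀ C ∈ Q, C.head ≠ none) {C : Clause S} (hC : C ∈ Q) {K : Atom S}
    (hK : C.head = some K) {v : Valuation S} (hc : C.constr.Holds v)
    (hB : ConjHolds (leastModel Q) v C.body) :
    weight ℓ cost Q (K.ground v) ≤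
      cost C + levelWeight ℓ (weight ℓ cost Q) (ℓ K.pred) v C.body :=
  Nat.sInf_le (.intro C hC K hK v hc _ fun A hA => derives_weight hQ (hB A hA))

/-- A cheapest proof of a ground atom ends with an instance of a clause. -/
theorem exists_clause_weight (hQ : ∀ C ∈ Q, C.head ≠ none) {g : Ground S}
    (h : leastModel Q g.1 g.2) :
    ∃ C ∈ Q, ∃ K v, C.head = some K ∧ K.ground v = g ∧ C.constr.Holds v ∧
      ConjHolds (leastModel Q) v C.body ∧
      cost C + levelWeight ℓ (weight ℓ cost Q) (ℓ K.pred) v C.body ≤ weight ℓ cost Q g := by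
  have hd := derives_weight (ℓ := ℓ) (cost := cost) hQ h
  generalize hk : weight ℓ cost Q g = k at hd
  cases hd with
  | intro C hC K hK v hc f hf =>
    refine ⟨C, hC, K, v, hK, rfl, hc, fun A hA => (hf A hA).leastModel, ?_⟩
    -- Replacing the costs of the given subproofs by the least possible ones only lowers the sum.
    exact Nat.add_le_add_left (levelWeight_le fun A hA => Nat.sInf_le (hf A hA)) _

end weight

/-! ### Covering ground heads by clause instances -/

/-- The instance of `C` under `v` has the head `h` (where `none` is `false`), its body is true in
`M`, the levels do not increase from the head to the body, the body atoms at the level of the head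
have predicates in `Z`, and their total weight is less than `N`. -/
structure CoveredBy (ℓ : S.Pred → ℕ) (Z : Set S.Pred) (M : Interp S) (w : Ground S → ℕ)
    (h : Option (Ground S)) (N : ℕ) (C : Clause S) (v : Valuation S) : Prop where
  head : C.head.map (Atom.ground v) = h
  constr : C.constr.Holds v
  body : ConjHolds M v C.body
  level : ∀ A ∈ C.body, (ℓ A.pred : WithTop ℕ) ≤ headLevel ℓ C.head
  mem : ∀ A ∈ C.body, (ℓ A.pred : WithTop ℕ) = headLevel ℓ C.head → A.pred ∈ Z
  weight : levelWeight ℓ w (headLevel ℓ C.head) v C.body < N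

/-- Some instance of a clause of `P` covers `h`. -/
def Covered (ℓ : S.Pred → ℕ) (Z : Set S.Pred) (M : Interp S) (w : Ground S → ℕ)
    (P : Set (Clause S)) (h : Option (Ground S)) (N : ℕ) : Prop :=
  ∃ C ∈ P, ∃ v, CoveredBy ℓ Z M w h N C v

theorem headLevel_map_subst (ℓ : S.Pred → ℕ) (θ : Subst S) (h : Option (Atom S)) :
    headLevel ℓ (h.map (Atom.subst θ)) = headLevel ℓ h := by
  cases h <;> rfl

theorem map_ground_map_subst (θ : Subst S) (v : Valuation S) (h : Option (Atom S)) :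
    (h.map (Atom.subst θ)).map (Atom.ground v) = h.map (Atom.ground (θ.eval v)) := by
  cases h <;> simp [Atom.ground_subst]

section Covered

variable {ℓ : S.Pred → ℕ} {Z : Set S.Pred} {M : Interp S} {w : Ground S → ℕ}
  {h : Option (Ground S)} {N : ℕ} {C : Clause S} {v : Valuation S}

theorem CoveredBy.subst {θ : Subst S} (hC : CoveredBy ℓ Z M w h N C (θ.eval v)) :
    CoveredBy ℓ Z M w h N (C.subst θ) v where
  head := (map_ground_map_subst θ v C.head).trans hC.head
  constr := (Constraint.holds_subst θ v _).2 hC.constr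
  body := (conjHolds_map_subst θ v _).2 hC.body
  level := by
    intro A hA
    obtain ⟨B, hB, rfl⟩ := Multiset.mem_map.1 hA
    exact (hC.level B hB).trans_eq (headLevel_map_subst ℓ θ _).symm
  mem := by
    intro A hA hl
    obtain ⟨B, hB, rfl⟩ := Multiset.mem_map.1 hA
    exact hC.mem B hB (hl.trans (headLevel_map_subst ℓ θ _))
  weight := by
    change levelWeight ℓ w (headLevel ℓ (C.head.map _)) v (C.body.map _) < N
    rw [levelWeight_map_subst, headLevel_map_subst]
    exact hC.weight

theorem CoveredBy.exists_variant {C' : Clause S} (hC : CoveredBy ℓ Z M w h N C v)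
    (hv : IsVariant C C') : ∃ v', CoveredBy ℓ Z M w h N C' v' := by
  obtain ⟨ρ, rfl⟩ := hv
  refine ⟨_, CoveredBy.subst (v := fun s n => v s ((ρ s).symm n)) ?_⟩
  rwa [varSubst_symm_eval]

theorem CoveredBy.congr {v' : Valuation S} (hC : CoveredBy ℓ Z M w h N C v)
    (e : ∀ x ∈ C.vars, v x.1 x.2 = v' x.1 x.2) : CoveredBy ℓ Z M w h N C v' where
  head := by
    rw [← hC.head]
    cases hK : C.head with
    | none => rfl
    | some K =>
      have : K.ground v = K.ground v' := K.ground_congr fun x hx =>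
        e x (Or.inl (Or.inl (by rw [hK]; exact hx)))
      simp [this]
  constr := (C.constr.holds_congr fun x hx => e x (Or.inl (Or.inr hx))).1 hC.constr
  body := (conjHolds_congr fun x hx => e x (Or.inr hx)).1 hC.body
  level := hC.level
  mem := hC.mem
  weight := levelWeight_congr (fun x hx => e x (Or.inr hx)) ▸ hC.weight

/-- Replacing a part `F` of the body of a clause by `F'`. -/
theorem CoveredBy.replace {N' : ℕ} {c : Constraint S} {F F' G : Multiset (Atom S)}
    (hC : CoveredBy ℓ Z M w h N C v) (hbody : C.body = G + F) (hc : c.Holds v)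
    (hF' : ConjHolds M v F') (hl : ∀ A ∈ F', (ℓ A.pred : WithTop ℕ) ≤ headLevel ℓ C.head)
    (hZ : ∀ A ∈ F', (ℓ A.pred : WithTop ℕ) = headLevel ℓ C.head → A.pred ∈ Z)
    -- The change of weight against the change of bound, written additively to avoid truncated
    -- subtraction.
    (hw : levelWeight ℓ w (headLevel ℓ C.head) v F' + N ≤
      levelWeight ℓ w (headLevel ℓ C.head) v F + N') :
    CoveredBy ℓ Z M w h N' ⟨C.head, c, G + F'⟩ v where
  head := hC.head
  constr := hc
  body := conjHolds_add.2 ⟨(conjHolds_add.1 (hbody ▸ hC.body)).1, hF'⟩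
  level := by
    intro A hA
    rcases Multiset.mem_add.1 hA with hA | hA
    · exact hC.level A (hbody ▸ Multiset.mem_add.2 (Or.inl hA))
    · exact hl A hA
  mem := by
    intro A hA
    rcases Multiset.mem_add.1 hA with hA | hA
    · exact hC.mem A (hbody ▸ Multiset.mem_add.2 (Or.inl hA))
    · exact hZ A hA
  weight := by
    have := hC.weight
    rw [hbody, levelWeight_add] at this
    change levelWeight ℓ w (headLevel ℓ C.head) v (G + F') < N'
    rw [levelWeight_add]
    omega

theorem Covered.mono {P P' : Set (Clause S)} (hP : P ⊆ P') (hC : Covered ℓ Z M w P h N) :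
    Covered ℓ Z M w P' h N :=
  let ⟨C, hCP, v, hv⟩ := hC
  ⟨C, hP hCP, v, hv⟩

/-- If a clause is replaced by a clause that covers as much, then the new set covers as much. -/
theorem Covered.replaced {P P' : Set (Clause S)} {E : Clause S} (hP : Covered ℓ Z M w P h N)
    (hr : Replaced P P' C E)
    (hE : ∀ v, CoveredBy ℓ Z M w h N C v → ∃ v', CoveredBy ℓ Z M w h N E v') :
    Covered ℓ Z M w P' h N := by
  obtain ⟨-, E', hEE', rfl⟩ := hr
  obtain ⟨C', hC', v, hv⟩ := hP
  by_cases hCC : C' = C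
  · subst hCC
    obtain ⟨v', hv'⟩ := hE v hv
    obtain ⟨v'', hv''⟩ := hv'.exists_variant hEE'
    exact ⟨E', Or.inr rfl, v'', hv''⟩
  · exact ⟨C', Or.inl ⟨hC', hCC⟩, v, hv⟩

end Covered

/-! ### Transformation sequences -/

/-- The definite clauses of the initial set together with the first definitions. -/
abbrev program (P : ℕ → Set (Clause S)) (r : ℕ → RuleApp S) (i : ℕ) : Set (Clause S) :=
  definite (P 0) ∪ defsAt r i

/-- The predicates that occur in the initial set or whose definition is used for folding. -/
def foldable (n : ℕ) (P : ℕ → Set (Clause S)) (r : ℕ → RuleApp S) : Set S.Pred :=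
  {p | OccursIn p (P 0) ∨
    ∃ i < n, ∃ C D K, r i = .folding C D ∧ D.head = some K ∧ K.pred = p}

open Classical in
/-- The clauses of the initial set cost one, the definitions nothing. -/
noncomputable def clauseCost (P₀ : Set (Clause S)) (C : Clause S) : ℕ := if C ∈ P₀ then 1 else 0

/-- The weight of the ground atoms with respect to all clauses of a transformation sequence. -/
noncomputable abbrev seqWeight (ℓ : S.Pred → ℕ) (n : ℕ) (P : ℕ → Set (Clause S))
    (r : ℕ → RuleApp S) : Ground S → ℕ :=
  weight ℓ (clauseCost (P 0)) (program P r n)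

/-- Covering with respect to the least model and the weights of a transformation sequence. -/
abbrev SeqCovered (ℓ : S.Pred → ℕ) (n : ℕ) (P : ℕ → Set (Clause S)) (r : ℕ → RuleApp S) :
    Set (Clause S) → Option (Ground S) → ℕ → Prop :=
  Covered ℓ (foldable n P r) (leastModel (program P r n)) (seqWeight ℓ n P r)

abbrev SeqCoveredBy (ℓ : S.Pred → ℕ) (n : ℕ) (P : ℕ → Set (Clause S)) (r : ℕ → RuleApp S) :
    Option (Ground S) → ℕ → Clause S → Valuation S → Prop :=
  CoveredBy ℓ (foldable n P r) (leastModel (program P r n)) (seqWeight ℓ n P r)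

theorem defsAt_mono (r : ℕ → RuleApp S) {i j : ℕ} (h : i ≤ j) : defsAt r i ⊆ defsAt r j :=
  fun _ ⟨k, hk, hD⟩ => ⟨k, hk.trans_le h, hD⟩

theorem program_mono (P : ℕ → Set (Clause S)) (r : ℕ → RuleApp S) {i j : ℕ} (h : i ≤ j) :
    program P r i ⊆ program P r j :=
  Set.union_subset_union_right _ (defsAt_mono r h)

theorem occursIn_of_mem_body {P : Set (Clause S)} {C : Clause S} (hC : C ∈ P) {A : Atom S}
    (hA : A ∈ C.body) : OccursIn A.pred P := ⟨C, hC, Or.inr ⟨A, hA, rfl⟩⟩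

theorem occursIn_of_head {P : Set (Clause S)} {C : Clause S} (hC : C ∈ P) {A : Atom S}
    (hA : C.head = some A) : OccursIn A.pred P := ⟨C, hC, Or.inl ⟨A, hA, rfl⟩⟩

namespace IsTransformationSequence

variable {ℓ : S.Pred → ℕ} {n : ℕ} {P : ℕ → Set (Clause S)} {r : ℕ → RuleApp S}

theorem step_eq (hseq : IsTransformationSequence ℓ n P r) {i : ℕ} (hi : i < n) {a : RuleApp S}
    (h : r i = a) : Step ℓ P r i a := h ▸ hseq.2.2 i hi

theorem definition_step (hseq : IsTransformationSequence ℓ n P r) {D : Clause S}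
    (hD : D ∈ defsAt r n) :
    ∃ k < n, r k = .definition D ∧ DefinitionRule ℓ P k D ∧ P (k + 1) = P k ∪ {D} :=
  let ⟨k, hk, hrk⟩ := hD
  ⟨k, hk, hrk, hseq.step_eq hk hrk⟩

theorem exists_head (hseq : IsTransformationSequence ℓ n P r) {D : Clause S}
    (hD : D ∈ defsAt r n) : ∃ K, D.head = some K :=
  let ⟨_, _, _, ⟨_, K, hK, _⟩, _⟩ := hseq.definition_step hD
  ⟨K, hK⟩

theorem not_occursIn_of_head (hseq : IsTransformationSequence ℓ n P r) {D : Clause S}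
    (hD : D ∈ defsAt r n) {K : Atom S} (hK : D.head = some K) : ¬ OccursIn K.pred (P 0) := by
  obtain ⟨k, -, -, ⟨-, K', hK', hnew, -⟩, -⟩ := hseq.definition_step hD
  obtain rfl : K = K' := Option.some.inj (hK.symm.trans hK')
  exact hnew 0 k.zero_le

theorem occursIn_of_body (hseq : IsTransformationSequence ℓ n P r) {D : Clause S}
    (hD : D ∈ defsAt r n) {A : Atom S} (hA : A ∈ D.body) : OccursIn A.pred (P 0) :=
  let ⟨_, _, _, ⟨_, _, _, _, h, _⟩, _⟩ := hseq.definition_step hD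
  h A hA

theorem level_eq (hseq : IsTransformationSequence ℓ n P r) {D : Clause S}
    (hD : D ∈ defsAt r n) {K : Atom S} (hK : D.head = some K) :
    ℓ K.pred = (D.body.map fun A => ℓ A.pred).sup := by
  obtain ⟨k, -, -, ⟨-, K', hK', -, -, -, -, h⟩, -⟩ := hseq.definition_step hD
  obtain rfl : K = K' := Option.some.inj (hK.symm.trans hK')
  exact h

theorem level_le (hseq : IsTransformationSequence ℓ n P r) {D : Clause S}
    (hD : D ∈ defsAt r n) {K A : Atom S} (hK : D.head = some K) (hA : A ∈ D.body) :
    ℓ A.pred ≤ ℓ K.pred := by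
  rw [hseq.level_eq hD hK]
  exact Multiset.le_sup (Multiset.mem_map_of_mem (fun A : Atom S => ℓ A.pred) hA)

/-- A predicate has at most one definition. -/
theorem definition_unique (hseq : IsTransformationSequence ℓ n P r) {D D' : Clause S}
    (hD : D ∈ defsAt r n) (hD' : D' ∈ defsAt r n) {K K' : Atom S} (hK : D.head = some K)
    (hK' : D'.head = some K') (h : K.pred = K'.pred) : D = D' := by
  obtain ⟨k, -, hrk, ⟨-, L, hL, hnew, -⟩, hP⟩ := hseq.definition_step hD
  obtain ⟨k', -, hrk', ⟨-, L', hL', hnew', -⟩, hP'⟩ := hseq.definition_step hD'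
  obtain rfl : K = L := Option.some.inj (hK.symm.trans hL)
  obtain rfl : K' = L' := Option.some.inj (hK'.symm.trans hL')
  -- Of two definitions introduced at different steps, the earlier one already puts the predicate
  -- into the set, so it is not new for the later one.
  rcases lt_trichotomy k k' with hlt | rfl | hlt
  · refine absurd ?_ (hnew' (k + 1) hlt)
    rw [← h, hP]
    exact occursIn_of_head (Or.inr rfl) hK
  · exact RuleApp.definition.inj (hrk.symm.trans hrk')
  · refine absurd ?_ (hnew (k' + 1) hlt)
    rw [h, hP']
    exact occursIn_of_head (Or.inr rfl) hK'

theorem program_head_ne_none (hseq : IsTransformationSequence ℓ n P r) :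
    ∀ C ∈ program P r n, C.head ≠ none := by
  rintro C (hC | hC)
  · exact hC.2
  · obtain ⟨K, hK⟩ := hseq.exists_head hC
    simp [hK]

/-- Later definitions do not matter for the truth of the atoms of the current clauses. -/
theorem holds_leastModel_program (hseq : IsTransformationSequence ℓ n P r) {i : ℕ} (hi : i < n)
    {v : Valuation S} {A : Atom S} (hA : A.Holds (leastModel (program P r n)) v)
    (hAP : OccursIn A.pred (P i)) : A.Holds (leastModel (program P r i)) v := by
  -- The excluded predicates are those defined at step `i` or later. They are new at that point, so
  -- they occur neither in `program P r i` nor in `P i`.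
  refine leastModel_of_union
    {p | ∃ k < n, i ≤ k ∧ ∃ D K, r k = .definition D ∧ D.head = some K ∧ K.pred = p} ?_ ?_ hA ?_
  · rintro C hC B hB ⟨k, hk, -, D, K, hrk, hK, hKB⟩
    refine hseq.not_occursIn_of_head ⟨k, hk, hrk⟩ hK ?_
    rw [hKB]
    rcases hC with hC | hC
    · exact occursIn_of_mem_body hC.1 hB
    · exact hseq.occursIn_of_body (defsAt_mono r hi.le hC) hB
  · rintro C (hC | ⟨k, hk, hrk⟩)
    · exact Or.inl (Or.inl hC)
    · rcases lt_or_ge k i with hki | hki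
      · exact Or.inl (Or.inr ⟨k, hki, hrk⟩)
      · obtain ⟨K, hK⟩ := hseq.exists_head ⟨k, hk, hrk⟩
        exact Or.inr ⟨K, hK, k, hk, hki, C, K, hrk, hK, rfl⟩
  · rintro ⟨k, hk, hik, D, K, hrk, hK, hKA⟩
    obtain ⟨⟨-, K', hK', hnew, -⟩, -⟩ := hseq.step_eq hk hrk
    obtain rfl : K = K' := Option.some.inj (hK.symm.trans hK')
    exact hnew i hik (hKA ▸ hAP)

/-- In every clause, the terms of basic type in the body atoms with old predicates are variables. -/
theorem basicVars_body (hne : ∀ s : Srt S.Adt, Nonempty (Val S s))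
    (hseq : IsTransformationSequence ℓ n P r) {i : ℕ} (hi : i ≤ n) :
    ∀ C ∈ P i, ∀ A ∈ C.body, OccursIn A.pred (P 0) → A.BasicVars := by
  induction i with
  | zero => exact fun C hC A hA _ => (hseq.1 C hC).2 A hA
  | succ i ih =>
    have ih := ih (Nat.le_of_succ_le hi)
    have hstep := hseq.2.2 i hi
    have hdef : ∀ D ∈ defsAt r i, ∀ D', IsVariant D D' → ∀ A ∈ D'.body, A.BasicVars := by
      rintro D hD D' ⟨ρ, rfl⟩ A hA
      obtain ⟨k, -, -, ⟨hb, -⟩, -⟩ := hseq.definition_step (defsAt_mono r (Nat.le_of_succ_le hi) hD)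
      obtain ⟨B, hB, rfl⟩ := Multiset.mem_map.1 hA
      exact (hb.2 B hB).subst (basicVars_varSubst _)
    have hrepl : ∀ C E, Replaced (P i) (P (i + 1)) C E →
        (∀ A ∈ E.body, OccursIn A.pred (P 0) → A ∈ C.body ∨ A.BasicVars) →
        ∀ C ∈ P (i + 1), ∀ A ∈ C.body, OccursIn A.pred (P 0) → A.BasicVars := by
      rintro C E ⟨hC, E', ⟨ρ, rfl⟩, hP⟩ hE C' hC' A hA hocc
      rw [hP] at hC'
      rcases hC' with hC' | rfl
      · exact ih C' hC'.1 A hA hocc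
      · obtain ⟨B, hB, rfl⟩ := Multiset.mem_map.1 hA
        refine Atom.BasicVars.subst (basicVars_varSubst _) ?_
        exact (hE B hB hocc).elim (fun h => ih C hC B h hocc) id
    cases hr : r i with
    | definition D =>
      rw [hr] at hstep
      intro C hC A hA hocc
      rw [hstep.2] at hC
      rcases hC with hC | rfl
      · exact ih C hC A hA hocc
      · exact hstep.1.1.2 A hA
    | unfolding C A =>
      rw [hr] at hstep
      obtain ⟨hC, U, ⟨hocc, G, hG, ren, mgu, hren, rfl⟩, hP⟩ := hstep
      intro C' hC' A' hA' hocc'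
      rw [hP] at hC'
      rcases hC' with hC' | ⟨K, hK, B, hB, hAB, -, rfl⟩
      · exact ih C' hC'.1 A' hA' hocc'
      · obtain ⟨⟨ρ, hρ⟩, -, hmgu⟩ := hren K hK
        have hAb : A.BasicVars := ih C hC A (hG ▸ Multiset.mem_cons_self A G) hocc
        have hBb : B.BasicVars := by
          rw [hρ] at hB
          obtain ⟨B', hB', rfl⟩ := Option.map_eq_some_iff.1 hB
          exact ((hseq.1 K hK).1 B' hB').subst (basicVars_varSubst _)
        obtain ⟨A'', hA'', rfl⟩ := Multiset.mem_map.1 hA'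
        refine Atom.BasicVars.subst ((hmgu B hB hAB).basicVars hne hAb hBb) ?_
        rcases Multiset.mem_add.1 hA'' with h | h
        · exact ih C hC A'' (hG ▸ Multiset.mem_cons_of_mem h) hocc'
        · rw [hρ] at h
          obtain ⟨B', hB', rfl⟩ := Multiset.mem_map.1 h
          exact ((hseq.1 K hK).2 B' hB').subst (basicVars_varSubst _)
    | folding C D =>
      rw [hr] at hstep
      obtain ⟨hD, E, ⟨D', K, G, θ, ⟨ρ, rfl⟩, hK, -, hbody, -, rfl⟩, hR⟩ := hstep
      refine hrepl C _ hR fun A hA hocc => ?_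
      rcases Multiset.mem_add.1 hA with hA | hA
      · exact Or.inl (hbody ▸ Multiset.mem_add.2 (Or.inl hA))
      · obtain rfl := Multiset.mem_singleton.1 hA
        obtain ⟨K', hK', rfl⟩ := Option.map_eq_some_iff.1 hK
        -- The atom added by folding has a new predicate, so the claim, restricted to old
        -- predicates, does not concern it.
        exact (hseq.not_occursIn_of_head (defsAt_mono r (Nat.le_of_succ_le hi) hD) hK' hocc).elim
    | clauseDeletion C =>
      rw [hr] at hstep
      intro C' hC'
      rw [hstep.2.2] at hC'
      exact ih C' hC'.1
    | functionality C =>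
      rw [hr] at hstep
      obtain ⟨E, ⟨F, G, X, Y, ρ, -, -, -, -, hbody, rfl⟩, hR⟩ := hstep
      exact hrepl C _ hR fun A hA _ => Or.inl (hbody ▸ Multiset.mem_add.2 (Or.inl hA))
    | totality C =>
      rw [hr] at hstep
      obtain ⟨E, ⟨F, G, X, Y, -, hbody, rfl, -⟩, hR⟩ := hstep
      exact hrepl C _ hR fun A hA _ => Or.inl (hbody ▸ Multiset.mem_add.2 (Or.inl hA))
    | differentialReplacement C D =>
      rw [hr] at hstep
      obtain ⟨hD, E, ⟨D', K, F, R, G, X, Y, V, W, hv, hK, hDb, hbody, -, -, -, -, -, -, -, rfl⟩, hR⟩ :=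
        hstep
      refine hrepl C _ hR fun A hA hocc => ?_
      rcases Multiset.mem_add.1 hA with hA | hA
      · rcases Multiset.mem_add.1 hA with hA | hA
        · exact Or.inl (hbody ▸ Multiset.mem_add.2 (Or.inl hA))
        · exact Or.inr (hdef D hD D' hv A (hDb ▸ Multiset.mem_add.2 (Or.inr hA)))
      · obtain rfl := Multiset.mem_singleton.1 hA
        obtain ⟨ρ, rfl⟩ := hv
        obtain ⟨K', hK', rfl⟩ := Option.map_eq_some_iff.1 hK
        exact (hseq.not_occursIn_of_head (defsAt_mono r (Nat.le_of_succ_le hi) hD) hK' hocc).elim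

/-! ### Covering and its preservation by the rules -/

/-- Every true ground atom is covered by a clause of the initial set or by a definition. -/
theorem exists_coveredBy (hseq : IsTransformationSequence ℓ n P r) {g : Ground S}
    (hg : leastModel (program P r n) g.1 g.2) :
    (∃ C ∈ P 0, ∃ v, SeqCoveredBy ℓ n P r (some g) (seqWeight ℓ n P r g) C v) ∨
    ∃ D ∈ defsAt r n, ∃ v, SeqCoveredBy ℓ n P r (some g) (seqWeight ℓ n P r g + 1) D v := by
  obtain ⟨C, hC, K, v, hK, hKg, hc, hB, hw⟩ :=
    exists_clause_weight (ℓ := ℓ) (cost := clauseCost (P 0)) hseq.program_head_ne_none hg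
  have hhead : C.head.map (Atom.ground v) = some g := by rw [hK, ← hKg]; rfl
  have hl : headLevel ℓ C.head = (ℓ K.pred : WithTop ℕ) := by rw [hK]; rfl
  rw [← hl] at hw
  change _ + levelWeight ℓ (seqWeight ℓ n P r) _ _ _ ≤ seqWeight ℓ n P r g at hw
  -- The unit cost of an initial clause gives the strict inequality; a definition is free, hence the
  -- bound larger by one.
  rcases hC with hC | hC
  · refine Or.inl ⟨C, hC.1, v, hhead, hc, hB, hseq.2.1 C hC.1,
      fun A hA _ => Or.inl (occursIn_of_mem_body hC.1 hA), ?_⟩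
    rw [clauseCost, if_pos hC.1] at hw
    omega
  · refine Or.inr ⟨C, hC, v, hhead, hc, hB, fun A hA => ?_,
      fun A hA _ => Or.inl (hseq.occursIn_of_body hC hA), by omega⟩
    rw [hl]
    exact_mod_cast hseq.level_le hC hK hA

theorem headLevel_variant {D D' : Clause S} (h : IsVariant D D') :
    headLevel ℓ D'.head = headLevel ℓ D.head := by
  obtain ⟨ρ, rfl⟩ := h
  exact headLevel_map_subst ℓ _ _

/-- Unfolding replaces a covering instance by another one, of smaller weight if the unfolded atom
has the level of the head. -/
theorem covered_unfolding (hne : ∀ s : Srt S.Adt, Nonempty (Val S s))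
    (hseq : IsTransformationSequence ℓ n P r) {i : ℕ} (hi : i < n) {C : Clause S} {A : Atom S}
    (hr : r i = .unfolding C A) {h : Option (Ground S)} {N N' : ℕ} {v : Valuation S}
    (hCv : SeqCoveredBy ℓ n P r h N C v)
    (hN : N ≤ N' ∨ (ℓ A.pred : WithTop ℕ) = headLevel ℓ C.head ∧ N ≤ N' + 1) :
    SeqCovered ℓ n P r (P (i + 1)) h N' := by
  obtain ⟨hC, U, ⟨hocc, G, hG, ren, mgu, hren, rfl⟩, hP⟩ := hseq.step_eq hi hr
  have hAC : A ∈ C.body := hG ▸ Multiset.mem_cons_self A G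
  obtain ⟨K, hK, v₀, hKv₀⟩ : ∃ K ∈ P 0, ∃ v₀, SeqCoveredBy ℓ n P r (some (A.ground v))
      (seqWeight ℓ n P r (A.ground v)) K v₀ := by
    -- The unfolded atom has an old predicate, so its cheapest proof cannot end with a definition.
    refine (hseq.exists_coveredBy (g := A.ground v) (hCv.body A hAC)).resolve_right ?_
    rintro ⟨D, hD, v₀, hDv₀⟩
    obtain ⟨B, hB⟩ := hseq.exists_head hD
    refine hseq.not_occursIn_of_head hD hB ?_
    have := hDv₀.head
    rw [hB] at this
    have hpred : B.pred = A.pred := congrArg Sigma.fst (Option.some.inj this)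
    rwa [hpred]
  obtain ⟨hvar, hdisj, hmgu⟩ := hren K hK
  obtain ⟨v₁, hKv₁⟩ := hKv₀.exists_variant hvar
  classical
  -- As the two clauses share no variables, their valuations glue to one that makes `A` and the
  -- renamed head equal.
  let u : Valuation S := fun s m => if (s, m) ∈ C.vars then v s m else v₁ s m
  have huv : ∀ x ∈ C.vars, v x.1 x.2 = u x.1 x.2 := fun x hx => (if_pos hx).symm
  have huv₁ : ∀ x ∈ (ren K).vars, v₁ x.1 x.2 = u x.1 x.2 := fun x hx =>
    (if_neg fun hx' => Set.disjoint_left.1 hdisj hx' hx).symm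
  have hAu : A.ground v = A.ground u :=
    A.ground_congr fun x hx => huv x (Or.inr ⟨A, hAC, hx⟩)
  have hCu := hCv.congr huv
  have hKu := hKv₁.congr huv₁
  rw [hAu] at hKu
  obtain ⟨B, hB, hBu⟩ := Option.map_eq_some_iff.1 hKu.head
  have hAb : A.BasicVars := hseq.basicVars_body hne hi.le C hC A hAC hocc
  have hBb : B.BasicVars := by
    obtain ⟨ρ, hρ⟩ := hvar
    rw [hρ] at hB
    obtain ⟨B', hB', rfl⟩ := Option.map_eq_some_iff.1 hB
    exact ((hseq.1 K hK).1 B' hB').subst (basicVars_varSubst _)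
  have hunif : Unifiable A B := ⟨_, isUnifier_of_ground_eq hAb hBb hBu.symm⟩
  -- The glued valuation factors through the most general unifier, so the instance found is an
  -- instance of the resolvent.
  obtain ⟨w, hw⟩ := (hmgu B hB hunif).exists_eval_eq hne hAb hBb hBu.symm
  have hlB : headLevel ℓ (ren K).head = (ℓ A.pred : WithTop ℕ) := by
    rw [hB]
    exact congrArg (fun g : Ground S => (ℓ g.1 : WithTop ℕ)) hBu
  have hlA := hCu.level A hAC
  have hlev := hKu.level
  have hmem := hKu.mem
  have hwt := hKu.weight
  rw [hlB] at hlev hmem hwt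
  have hbody : C.body = G + {A} := by rw [hG, add_comm, Multiset.singleton_add]
  have hres : SeqCoveredBy ℓ n P r h N'
      ⟨C.head, .and C.constr (ren K).constr, G + (ren K).body⟩ u := by
    refine hCu.replace hbody ⟨hCu.constr, hKu.constr⟩ hKu.body
      (fun A' hA' => (hlev A' hA').trans hlA)
      (fun A' hA' hl => hmem A' hA' (le_antisymm (hlev A' hA') (hl ▸ hlA))) ?_
    rw [levelWeight_singleton]
    -- At the head level, `A` gives way to strictly lighter atoms, which gains one unit. Below it,
    -- neither `A` nor its replacements are counted.
    by_cases hl : (ℓ A.pred : WithTop ℕ) = headLevel ℓ C.head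
    · rw [if_pos hl, ← hl]
      omega
    · rw [if_neg hl, levelWeight_eq_zero fun A' hA' hl' =>
        hl (le_antisymm hlA (hl'.symm.trans_le (hlev A' hA')))]
      have := hN.resolve_right fun h => hl h.1
      omega
  rw [← hw] at hres
  rw [hP]
  exact ⟨_, Or.inr ⟨K, hK, B, hB, hunif, ⟨w, hres.subst.constr⟩, rfl⟩, w, hres.subst⟩

theorem holds_tupleEq {ρ : Srt S.Adt → ℕ → ℕ} {v : Valuation S} {Y : List (Var S)}
    (h : ∀ y ∈ Y, v y.1 y.2 = v y.1 (ρ y.1 y.2)) : (tupleEq ρ Y).Holds v := by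
  induction Y with
  | nil => trivial
  | cons y Y ih =>
    exact ⟨h y List.mem_cons_self, ih fun z hz => h z (List.mem_cons_of_mem y hz)⟩

/-- Definitions, and hence their variants, are true in the least model. -/
theorem holds_head_definition (hseq : IsTransformationSequence ℓ n P r) {D D' : Clause S}
    (hD : D ∈ defsAt r n) (hvar : IsVariant D D') {K : Atom S} (hK : D'.head = some K)
    {v : Valuation S} (hc : D'.constr.Holds v)
    (hB : ConjHolds (leastModel (program P r n)) v D'.body) :
    K.Holds (leastModel (program P r n)) v ∧
      seqWeight ℓ n P r (K.ground v) ≤ levelWeight ℓ (seqWeight ℓ n P r) (ℓ K.pred) v D'.body := by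
  obtain ⟨ρ, rfl⟩ := hvar
  obtain ⟨L, hL, rfl⟩ := Option.map_eq_some_iff.1 hK
  have hc' := (Constraint.holds_subst _ v _).1 hc
  have hB' := (conjHolds_map_subst _ v _).1 hB
  have hDP : D ∉ P 0 := fun h => hseq.not_occursIn_of_head hD hL (occursIn_of_head h hL)
  constructor
  · have := leastModel_isModel hseq.program_head_ne_none D (Or.inr hD) _ hc' hB'
    rw [hL] at this
    exact (Atom.holds_subst _ v L).2 this
  · have := weight_le (ℓ := ℓ) (cost := clauseCost (P 0)) hseq.program_head_ne_none
      (Or.inr hD) hL hc' hB'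
    rw [clauseCost, if_neg hDP, Nat.zero_add, ← Atom.ground_subst] at this
    exact this.trans_eq (levelWeight_map_subst _ _).symm

/-- A definition costs nothing, so its head is no heavier than the body instance it replaces when
both are measured at the level of that head. If this level is below that of `C`, the new atom is not
counted at all. -/
theorem covered_folding (hseq : IsTransformationSequence ℓ n P r) {i : ℕ} (hi : i < n)
    {C D E : Clause S} (hr : r i = .folding C D) (hD : D ∈ defsAt r i)
    (hE : FoldingRule ℓ C D E) {h : Option (Ground S)} {N : ℕ} {v : Valuation S}
    (hCv : SeqCoveredBy ℓ n P r h N C v) : SeqCoveredBy ℓ n P r h N E v := by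
  obtain ⟨D', K, G, θ, hvar, hK, hl, hbody, hent, rfl⟩ := hE
  have hB := (conjHolds_add.1 (hbody ▸ hCv.body)).2
  obtain ⟨hKM, hKw⟩ := hseq.holds_head_definition (defsAt_mono r hi.le hD) hvar hK
    ((Constraint.holds_subst θ v _).1 (hent v hCv.constr)) ((conjHolds_map_subst θ v _).1 hB)
  have hZ : K.pred ∈ foldable n P r := by
    obtain ⟨ρ, rfl⟩ := hvar
    obtain ⟨L, hL, rfl⟩ := Option.map_eq_some_iff.1 hK
    exact Or.inr ⟨i, hi, C, D, L, hr, hL, rfl⟩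
  refine hCv.replace hbody hCv.constr ?_ ?_ ?_ ?_
  · intro A hA
    obtain rfl := Multiset.mem_singleton.1 hA
    exact (Atom.holds_subst θ v K).2 hKM
  · intro A hA
    obtain rfl := Multiset.mem_singleton.1 hA
    exact hl
  · intro A hA _
    obtain rfl := Multiset.mem_singleton.1 hA
    exact hZ
  · rw [levelWeight_singleton, levelWeight_map_subst]
    refine Nat.add_le_add_right ?_ N
    split_ifs with hKl
    · rw [Atom.ground_subst, ← hKl]
      exact hKw
    · exact Nat.zero_le _

theorem covered_functionality (hseq : IsTransformationSequence ℓ n P r) {i : ℕ} (hi : i < n)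
    {C E : Clause S} (hC : C ∈ P i) (hE : FunctionalityRule (program P r i) C E)
    {h : Option (Ground S)} {N : ℕ} {v : Valuation S} (hCv : SeqCoveredBy ℓ n P r h N C v) :
    SeqCoveredBy ℓ n P r h N E v := by
  obtain ⟨F, G, X, Y, ρ, ⟨-, hfun⟩, hX, -, -, hbody, rfl⟩ := hE
  have hall : ConjHolds (leastModel (program P r i)) v C.body := fun A hA =>
    hseq.holds_leastModel_program hi (hCv.body A hA) (occursIn_of_mem_body hC hA)
  rw [hbody] at hall
  -- Functionality is applied to `v` and to `v` composed with `ρ`; they agree on `X`, and both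
  -- satisfy `F`.
  have hY : (tupleEq ρ Y).Holds v := holds_tupleEq <|
    hfun v ((varSubst ρ).eval v) (fun x hx => by simp [Subst.eval, varSubst, Term.eval, hX x hx])
      (conjHolds_add.1 (conjHolds_add.1 hall).1).2
      ((conjHolds_map_subst _ v F).1 (conjHolds_add.1 hall).2)
  have := hCv.replace (N' := N) (F' := 0) hbody (c := .and C.constr (tupleEq ρ Y))
    ⟨hCv.constr, hY⟩ (by simp [ConjHolds]) (by simp) (by simp) (by simp [levelWeight])
  rwa [add_zero] at this

/-- Deleting body atoms keeps the rest true and cannot increase the weight. -/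
theorem covered_totality {C E : Clause S} {Q : Set (Clause S)} (hE : TotalityRule Q C E)
    {h : Option (Ground S)} {N : ℕ} {v : Valuation S} (hCv : SeqCoveredBy ℓ n P r h N C v) :
    SeqCoveredBy ℓ n P r h N E v := by
  obtain ⟨F, G, X, Y, -, hbody, rfl, -⟩ := hE
  have := hCv.replace (N' := N) (F' := 0) hbody hCv.constr (by simp [ConjHolds]) (by simp)
    (by simp) (by simp [levelWeight])
  rwa [add_zero] at this

/-- Totality of `R` supplies values for the fresh variables `W` without disturbing `C`; the
definition then makes the differential atom true. All added atoms lie strictly below the head, so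
they are never counted. -/
theorem covered_differentialReplacement (hseq : IsTransformationSequence ℓ n P r) {i : ℕ}
    (hi : i < n) {C D E : Clause S} (hD : D ∈ defsAt r i)
    (hE : DifferentialReplacementRule ℓ (program P r i) C D E)
    {h : Option (Ground S)} {N : ℕ} {v : Valuation S} (hCv : SeqCoveredBy ℓ n P r h N C v) :
    ∃ v', SeqCoveredBy ℓ n P r h N E v' := by
  obtain ⟨D', K, F, R, G, X, Y, V, W, hvar, hK, hDb, hbody, -, -, -, ⟨hconj, htot⟩, hW, hent, hl,
    rfl⟩ := hE
  have hDn := defsAt_mono r hi.le hD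
  obtain ⟨w, hwV, hwR⟩ := htot v
  classical
  let u : Valuation S := fun s m => if (s, m) ∈ W then w s m else v s m
  have hCu : SeqCoveredBy ℓ n P r h N C u :=
    hCv.congr fun x hx => (if_neg fun hxW => hW x hxW hx).symm
  have hRu : ConjHolds (leastModel (program P r n)) u R := by
    refine (conjHolds_congr fun x hx => ?_).1
      fun A hA => leastModel_mono (program_mono P r hi.le) (hwR A hA)
    change w x.1 x.2 = if x ∈ W then w x.1 x.2 else v x.1 x.2
    split_ifs with hxW
    · rfl
    · exact hwV x (((hconj.2.2.2.2 x).1 hx).resolve_right hxW)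
  have hFu := (conjHolds_add.1 (hbody ▸ hCu.body)).2
  have hKu := (hseq.holds_head_definition hDn hvar hK (hent u hCu.constr)
    (hDb ▸ conjHolds_add.2 ⟨hFu, hRu⟩)).1
  -- The level of a definition's head bounds its body, so `R` inherits the strict inequality imposed
  -- on `K`.
  have hlt : ∀ A ∈ R + {K}, (ℓ A.pred : WithTop ℕ) < headLevel ℓ C.head := by
    intro A hA
    rcases Multiset.mem_add.1 hA with hA | hA
    · refine lt_of_le_of_lt ?_ hl
      have hAD : A ∈ D'.body := hDb ▸ Multiset.mem_add.2 (Or.inr hA)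
      obtain ⟨ρ, rfl⟩ := hvar
      obtain ⟨L, hL, rfl⟩ := Option.map_eq_some_iff.1 hK
      obtain ⟨B, hB, rfl⟩ := Multiset.mem_map.1 hAD
      exact_mod_cast hseq.level_le hDn hL hB
    · obtain rfl := Multiset.mem_singleton.1 hA
      exact hl
  refine ⟨u, ?_⟩
  rw [add_assoc]
  refine hCu.replace hbody hCu.constr (conjHolds_add.2 ⟨hRu, ?_⟩) (fun A hA => (hlt A hA).le)
    (fun A hA hl' => absurd hl' (hlt A hA).ne) ?_
  · intro A hA
    obtain rfl := Multiset.mem_singleton.1 hA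
    exact hKu
  · rw [levelWeight_eq_zero fun A hA => (hlt A hA).ne]
    omega

/-! ### Transfer to the last set and well-founded induction -/

/-- Every step keeps what is covered. -/
theorem covered_succ (hne : ∀ s : Srt S.Adt, Nonempty (Val S s))
    (hseq : IsTransformationSequence ℓ n P r) {i : ℕ} (hi : i < n) {h : Option (Ground S)} {N : ℕ}
    (hP : SeqCovered ℓ n P r (P i) h N) : SeqCovered ℓ n P r (P (i + 1)) h N := by
  have hstep := hseq.2.2 i hi
  cases hr : r i with
  | definition D =>
    rw [hr] at hstep
    refine hP.mono ?_
    rw [hstep.2]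
    exact Set.subset_union_left
  | unfolding C A =>
    obtain ⟨C', hC', v, hv⟩ := hP
    by_cases hCC : C' = C
    · subst hCC
      exact hseq.covered_unfolding hne hi hr hv (Or.inl le_rfl)
    · rw [hr] at hstep
      obtain ⟨-, U, -, hP'⟩ := hstep
      rw [hP']
      exact ⟨C', Or.inl ⟨hC', hCC⟩, v, hv⟩
  | folding C D =>
    rw [hr] at hstep
    obtain ⟨hD, E, hE, hR⟩ := hstep
    exact hP.replaced hR fun v hv => ⟨v, hseq.covered_folding hi hr hD hE hv⟩
  | clauseDeletion C =>
    rw [hr] at hstep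
    obtain ⟨C', hC', v, hv⟩ := hP
    rw [hstep.2.2]
    exact ⟨C', ⟨hC', fun hCC => hstep.2.1 ⟨v, hCC ▸ hv.constr⟩⟩, v, hv⟩
  | functionality C =>
    rw [hr] at hstep
    obtain ⟨E, hE, hR⟩ := hstep
    exact hP.replaced hR fun v hv => ⟨v, hseq.covered_functionality hi hR.1 hE hv⟩
  | totality C =>
    rw [hr] at hstep
    obtain ⟨E, hE, hR⟩ := hstep
    exact hP.replaced hR fun v hv => ⟨v, covered_totality hE hv⟩
  | differentialReplacement C D =>
    rw [hr] at hstep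
    obtain ⟨hD, E, hE, hR⟩ := hstep
    exact hP.replaced hR fun v hv => hseq.covered_differentialReplacement hi hD hE hv

theorem covered_last (hne : ∀ s : Srt S.Adt, Nonempty (Val S s))
    (hseq : IsTransformationSequence ℓ n P r) {i : ℕ} (hi : i ≤ n) {h : Option (Ground S)} {N : ℕ}
    (hP : SeqCovered ℓ n P r (P i) h N) : SeqCovered ℓ n P r (P n) h N := by
  have key : ∀ k, i ≤ k → k ≤ n → SeqCovered ℓ n P r (P k) h N := by
    intro k hik
    induction k, hik using Nat.le_induction with
    | base => exact fun _ => hP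
    | succ k _ ih => exact fun hk => hseq.covered_succ hne hk (ih (Nat.le_of_succ_le hk))
  exact key n hi le_rfl

open Classical in
/-- In the last set every true ground atom is covered by an instance whose body atoms are smaller. -/
theorem covered_of_leastModel (hne : ∀ s : Srt S.Adt, Nonempty (Val S s))
    (hseq : IsTransformationSequence ℓ n P r) (hU : ConditionU ℓ n r) {g : Ground S}
    (hg : leastModel (program P r n) g.1 g.2) :
    SeqCovered ℓ n P r (P n) (some g)
      (seqWeight ℓ n P r g + if g.1 ∈ foldable n P r then 0 else 1) := by
  rcases hseq.exists_coveredBy hg with ⟨C, hC, v, hv⟩ | ⟨D, hD, v, hv⟩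
  · obtain ⟨K, hK, rfl⟩ := Option.map_eq_some_iff.1 hv.head
    have hZ : (K.ground v).1 ∈ foldable n P r := Or.inl (occursIn_of_head hC hK)
    rw [if_pos hZ]
    exact hseq.covered_last hne n.zero_le ⟨C, hC, v, hv⟩
  · obtain ⟨K, hK, rfl⟩ := Option.map_eq_some_iff.1 hv.head
    split_ifs with hZ
    · obtain ⟨i, hi, C, D', K', hr, hK', hpred⟩ :=
        hZ.resolve_left (hseq.not_occursIn_of_head hD hK)
      have hD' := defsAt_mono r hi.le (hseq.step_eq hi hr).1
      obtain rfl := hseq.definition_unique hD' hD hK' hK hpred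
      -- The unfolding in (U) may come before or after the folding; it is itself evidence that the
      -- variant `D''` is present at step `j`, and it lowers the bound by the required one.
      obtain ⟨j, hj, D'', A, hvar, hrj, hl⟩ := hU i hi C D' hr
      obtain ⟨v', hv'⟩ := hv.exists_variant hvar
      refine hseq.covered_last hne hj (hseq.covered_unfolding hne hj hrj hv' (Or.inr ⟨?_, le_rfl⟩))
      rw [headLevel_variant hvar, hl]
    · obtain ⟨k, hk, -, -, hP⟩ := hseq.definition_step hD
      refine hseq.covered_last hne hk ⟨D, ?_, v, hv⟩
      rw [hP]
      exact Or.inr rfl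

/-- Every model of the last set contains the least model of the initial clauses and definitions. -/
theorem leastModel_le (hne : ∀ s : Srt S.Adt, Nonempty (Val S s))
    (hseq : IsTransformationSequence ℓ n P r) (hU : ConditionU ℓ n r) {I : Interp S}
    (hI : IsModel I (P n)) (g : Ground S) (hg : leastModel (program P r n) g.1 g.2) :
    I g.1 g.2 := by
  classical
  -- Doubling leaves room for a bit that puts a foldable atom below a non-foldable one of the same
  -- level and weight.
  let rank : Ground S → ℕ ×ₗ ℕ := fun g =>
    toLex (ℓ g.1, 2 * seqWeight ℓ n P r g + if g.1 ∈ foldable n P r then 0 else 1)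
  induction g using (InvImage.wf rank wellFounded_lt).induction with
  | _ g ih =>
    obtain ⟨C, hC, v, hv⟩ := hseq.covered_of_leastModel hne hU hg
    obtain ⟨K, hK, rfl⟩ := Option.map_eq_some_iff.1 hv.head
    have hl : headLevel ℓ C.head = (ℓ K.pred : WithTop ℕ) := by rw [hK]; rfl
    have := hI C hC v hv.constr fun A hA => by
      refine ih (A.ground v) (Prod.Lex.toLex_lt_toLex.2 ?_) (hv.body A hA)
      have hle := hv.level A hA
      have hmem := hv.mem A hA
      have hwt := hv.weight
      rw [hl] at hle hmem hwt
      rcases (Nat.cast_le.1 hle).lt_or_eq with hlt | heq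
      · exact Or.inl hlt
      · refine Or.inr ⟨heq, ?_⟩
        have hAl : (ℓ A.pred : WithTop ℕ) = ℓ K.pred := by rw [heq]
        have hAw := weight_le_levelWeight (w := seqWeight ℓ n P r) (v := v) hA hAl
        have hAZ : (A.ground v).1 ∈ foldable n P r := hmem hAl
        simp only [if_pos hAZ]
        -- For a foldable head the weight drops strictly; otherwise it may stay equal, and the bit
        -- drops from one to zero.
        split_ifs at hwt ⊢ <;> omega
    rw [hK] at this
    exact this

end IsTransformationSequence

end CHC

theorem theorem1 {S : CHC.Signature.{u}} (hne : ∀ s : CHC.Srt S.Adt, Nonempty (CHC.Val S s))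
    (ℓ : S.Pred → ℕ) (n : ℕ) (P : ℕ → Set (CHC.Clause S)) (r : ℕ → CHC.RuleApp S)
    (hseq : CHC.IsTransformationSequence ℓ n P r) (hU : CHC.ConditionU ℓ n r)
    (hsat : CHC.Satisfiable (P n)) : CHC.Satisfiable (P 0) := by
  obtain ⟨I, hI⟩ := hsat
  refine ⟨CHC.leastModel (CHC.program P r n), fun C hC v hc hB => ?_⟩
  cases hK : C.head with
  | some K =>
    have := CHC.leastModel_isModel hseq.program_head_ne_none C (Or.inl ⟨hC, by simp [hK]⟩) v hc hB
    rwa [hK] at this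
  | none =>
    -- No predicate has the level of `false`, so the counted weight is zero and the bound one
    -- suffices.
    have hcov : CHC.SeqCovered ℓ n P r (P 0) none 1 := by
      refine ⟨C, hC, v, by rw [hK]; rfl, hc, hB, hseq.2.1 C hC,
        fun A hA _ => Or.inl (CHC.occursIn_of_mem_body hC hA), ?_⟩
      rw [CHC.levelWeight_eq_zero fun A _ => by rw [hK]; exact WithTop.coe_ne_top]
      exact Nat.one_pos
    obtain ⟨E, hE, w, hw⟩ := hseq.covered_last hne n.zero_le hcov
    have := hI E hE w hw.constr fun A hA => hseq.leastModel_le hne hU hI (A.ground w) (hw.body A hA)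
    rwa [Option.map_eq_none_iff.1 hw.head] at this
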